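/- Let $\mathbb A$ be a complex composition algebra (the complexification of $\mathbb R$, $\mathbb C$, the quaternions or the octonions), or $\mathbb A=0$, with multiplicative norm form $N$ and polar form $N(x,y)=N(x+y)-N(x)-N(y)$, and let $\mathcal J_3(\mathbb A)$ be the space of $\mathbb A$-Hermitian matrices of order three with diagonal entries in $\mathbb C$, with its determinant, its comatrix $\mathrm{com}(r)$, and its trace form $\mathrm{tr}(r\circ s)$, $r\circ s=\frac12(rs+sr)$ (for $\mathbb A=0$: diagonal matrices). Put $r\times s=\mathrm{com}(r+s)-\mathrm{com}(r)-\mathrm{com}(s)$, $\langle r,s\rangle=\frac23\mathrm{tr}(r\circ s)$ and $C(r,s,t)=\langle r\times s,t\rangle$, so that $C(r,r,r)=4\det r$. Let $$\mathcal Z_2(\mathbb A)=\mathbb C\oplus \mathcal J_3(\mathbb A)\oplus \mathcal J_3(\mathbb A)\oplus\mathbb C ,$$ with elements $w=(\alpha,r,s,\beta)$, and let $$Q(w)=\bigl(3\alpha\beta-\tfrac12\langle r,s\rangle\bigr)^2+\tfrac13\bigl(\beta\,C(r,r,r)+\alpha\, C(s,s,s)\bigr)-\tfrac16\langle s\times s,\,r\times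 r\rangle .$$ Let $\mathfrak{sl}_3(\mathbb A)$ be the Lie algebra of linear endomorphisms $D$ of $\mathcal J_3(\mathbb A)$ with $C(Dr,r,r)=0$ for all $r$, and let $D'$ be defined by $\langle Dr,s\rangle+\langle r,D's\rangle=0$. Let $\mathfrak{sp}_6(\mathbb A)$ be the set of all endomorphisms of $\mathcal Z_2(\mathbb A)$ of the form $$(\alpha,r,s,\beta)\mapsto\bigl(-\tfrac32c\alpha+\tfrac12\langle r,u\rangle,\; Dr-\tfrac12cr+3\alpha t+s\times u,\; D's+\tfrac12cs+r\times t+3\beta u,\;\tfrac32c\beta+\tfrac12\langle t,s\rangle\bigr)$$ with $D\in\mathfrak{sl}_3(\mathbb A)$, $c\in\mathbb C$, $t,u\in\mathcal J_3(\mathbb A)$, and let $Sp_6(\mathbb A)\subset GL(\mathcal Z_2(\mathbb A))$ be the connected group generated by the exponentials of its elements. Let $\Delta_{\mathcal Z}\subset\mathcal Z_2(\mathbb A)$ be the space of elements $(p_0,p_1I,p_2I,p_3)$, identified with the space of binary cubics $p_0x^3+p_1x^2y+p_2xy^2+p_3y^3$, and let $$\Delta=3(3p_0p_3-p_1p_2)^2+4(p_0p_2^3+p_1^3p_3)-4p_1^2p_2^2$$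 be the classical discriminant (up to sign). Then $Q$ is an $Sp_6(\mathbb A)$-invariant quartic form, $3Q$ restricts to $\Delta$ on $\Delta_{\mathcal Z}$, and $3Q$ is the only $Sp_6(\mathbb A)$-invariant polynomial function (of any degree) on $\mathcal Z_2(\mathbb A)$ whose restriction to $\Delta_{\mathcal Z}$ is $\Delta$. Moreover, the restriction of $9Q$ to the elements $(\alpha,\mathrm{diag}(r_1,r_2,r_3),\mathrm{diag}(s_1,s_2,s_3),\beta)$ is Cayley's hyperdeterminant of the $2\times2\times2$ array with $a_{000}=3\alpha$, $a_{100}=r_1$, $a_{010}=r_2$, $a_{001}=r_3$, $a_{011}=s_1$, $a_{101}=s_2$, $a_{110}=s_3$, $a_{111}=3\beta$. In particular, for $\mathbb A=0$ the above characterizes the hyperdeterminant. -/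

import Mathlib

namespace Freudenthal

/-! ### Complex composition algebras -/

section Algebra

variable {A : Type*} [NonAssocRing A] [Module ℂ A]

/-- `N` makes the unital (not necessarily associative) complex algebra `A` a composition algebra:
`N` is a nondegenerate multiplicative quadratic form. By Hurwitz's theorem the nonzero
finite-dimensional examples are the complexifications of `ℝ`, `ℂ`, the quaternions and the
octonions. The zero algebra (with `N = 0`) satisfies the condition too. -/
structure IsComposition (N : QuadraticForm ℂ A) : Prop where
  map_mul : ∀ x y : A, N (x * y) = N x * N y
  nondegenerate : ∀ x : A, (∀ y : A, QuadraticMap.polar N x y = 0) → x = 0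

/-- The conjugate `x̄ = (x + x̄) - x`, where the trace `x + x̄` is `N(x, 1) · 1` for the polar
form `N(x, y) = N (x + y) - N x - N y`. -/
def conj (N : QuadraticForm ℂ A) (x : A) : A := QuadraticMap.polar N x 1 • (1 : A) - x

/-! ### Hermitian matrices of order three -/

/-- `𝒥₃(A)`: the element `(r, x)` is the `A`-Hermitian matrix
```
  r 0       conj x 2   conj x 1
  x 2       r 1        conj x 0
  x 1       x 0        r 2
```
with `r i ∈ ℂ` and `x i ∈ A`. -/
abbrev Herm3 (A : Type*) : Type _ := (Fin 3 → ℂ) × (Fin 3 → A)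

/-- The trace form `tr (P ∘ R)` of the Jordan product `P ∘ R = (PR + RP) / 2`. -/
def traceForm (N : QuadraticForm ℂ A) (P R : Herm3 A) : ℂ :=
  ∑ i, P.1 i * R.1 i + ∑ i, QuadraticMap.polar N (P.2 i) (R.2 i)

/-- The determinant of a Hermitian matrix of order three. -/
def det (N : QuadraticForm ℂ A) (P : Herm3 A) : ℂ :=
  P.1 0 * P.1 1 * P.1 2 - P.1 0 * N (P.2 0) - P.1 1 * N (P.2 1) - P.1 2 * N (P.2 2)
    + QuadraticMap.polar N (P.2 0 * P.2 2) (P.2 1)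

/-- The comatrix `P² - (tr P) P + ½ ((tr P)² - tr P²) I`, written out in coordinates. -/
def com (N : QuadraticForm ℂ A) (P : Herm3 A) : Herm3 A :=
  (![P.1 1 * P.1 2 - N (P.2 0), P.1 2 * P.1 0 - N (P.2 1), P.1 0 * P.1 1 - N (P.2 2)],
   ![P.2 1 * conj N (P.2 2) - P.1 0 • P.2 0,
     P.2 0 * P.2 2 - P.1 1 • P.2 1,
     conj N (P.2 0) * P.2 1 - P.1 2 • P.2 2])

/-- The polarized comatrix: a symmetric bilinear product with `cross P P = 2 com P`. -/
def cross (N : QuadraticForm ℂ A) (P R : Herm3 A) : Herm3 A :=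
  com N (P + R) - com N P - com N R

/-! ### The cubic form, the pairing and the dual cubic

Below `W = 𝒥₃(A)`, and `W*` is identified with `𝒥₃(A)` by the pairing
`⟨r, s⟩ = (2/3) tr (r ∘ s)`. The cubic form is `C(r³) = 4 det r`, with polarization
`C(r, s, t)`; so `C(r s) ∈ W*` is `cross r s`. The dual cubic `C*` is given on `W* = 𝒥₃(A)` by
the same formulas. In this normalization
`2⟨C*(s* C(rt)), C(r²)⟩ = ⟨t, s*⟩ C(r³) + 3 ⟨r, s*⟩ C(r² t)`. -/

/-- The pairing `⟨r, s⟩` of `W` with `W*`. -/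
noncomputable def pairing (N : QuadraticForm ℂ A) (r s : Herm3 A) : ℂ :=
  2 / 3 * traceForm N r s

/-- The symmetric trilinear form `C` with `C(r, r, r) = 4 det r`. -/
noncomputable def cubic (N : QuadraticForm ℂ A) (r s t : Herm3 A) : ℂ :=
  pairing N (cross N r s) t

theorem polar_self (N : QuadraticForm ℂ A) (x : A) : QuadraticMap.polar N x x = 2 * N x := by
  simp [QuadraticMap.polar_self]

theorem polar_mul_conj (N : QuadraticForm ℂ A) (h : IsComposition N)
    [SMulCommClass ℂ A A] (x y z : A) :
    QuadraticMap.polar N x (y * conj N z) = QuadraticMap.polar N (x * z) y := by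
  have h1 : ∀ a b c : A,
      QuadraticMap.polar N (a * c) (b * c) = QuadraticMap.polar N a b * N c := by
    intro a b c
    simp only [QuadraticMap.polar, ← add_mul, h.map_mul]
    ring
  have h2 : QuadraticMap.polar N (x * z) y + QuadraticMap.polar N x (y * z)
      = QuadraticMap.polar N x y * QuadraticMap.polar N z 1 := by
    have e := h1 x y (z + 1)
    have e2 := h1 x y z
    simp only [mul_add, mul_one, QuadraticMap.polar_add_left, QuadraticMap.polar_add_right] at e
    have : N (z + 1) = QuadraticMap.polar N z 1 + N z + N 1 := by
      simp only [QuadraticMap.polar]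
      ring
    have e3 := h1 x y 1
    simp only [mul_one] at e3
    rw [this, e2] at e
    linear_combination e - e3
  simp only [conj, mul_sub, mul_smul_comm, mul_one, QuadraticMap.polar_sub_right,
    QuadraticMap.polar_smul_right, smul_eq_mul]
  linear_combination -h2

theorem polar_conj_mul (N : QuadraticForm ℂ A) (h : IsComposition N)
    [IsScalarTower ℂ A A] (x y z : A) :
    QuadraticMap.polar N x (conj N z * y) = QuadraticMap.polar N (z * x) y := by
  have h1 : ∀ a b c : A,
      QuadraticMap.polar N (c * a) (c * b) = QuadraticMap.polar N a b * N c := by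
    intro a b c
    simp only [QuadraticMap.polar, ← mul_add, h.map_mul]
    ring
  have h2 : QuadraticMap.polar N (z * x) y + QuadraticMap.polar N x (z * y)
      = QuadraticMap.polar N x y * QuadraticMap.polar N z 1 := by
    have e := h1 x y (z + 1)
    have e2 := h1 x y z
    simp only [add_mul, one_mul, QuadraticMap.polar_add_left, QuadraticMap.polar_add_right] at e
    have : N (z + 1) = QuadraticMap.polar N z 1 + N z + N 1 := by
      simp only [QuadraticMap.polar]
      ring
    have e3 := h1 x y 1
    simp only [one_mul] at e3
    rw [this, e2] at e
    linear_combination e - e3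
  simp only [conj, sub_mul, smul_mul_assoc, one_mul, QuadraticMap.polar_sub_right,
    QuadraticMap.polar_smul_right, smul_eq_mul]
  linear_combination -h2

theorem cross_self (N : QuadraticForm ℂ A) [IsScalarTower ℂ A A]
    [SMulCommClass ℂ A A] (P : Herm3 A) :
    cross N P P = (2 : ℂ) • com N P := by
  have : com N (P + P) = (4 : ℂ) • com N P := by
    have hp : P + P = (2 : ℂ) • P := by module
    have hc : ∀ x : A, conj N ((2 : ℂ) • x) = (2 : ℂ) • conj N x := by
      intro x
      simp only [conj, QuadraticMap.polar_smul_left, smul_sub, smul_smul, smul_eq_mul]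
    rw [hp]
    refine Prod.ext ?_ ?_
    · funext i
      fin_cases i <;> simp [com, QuadraticMap.map_smul] <;> ring
    · funext i
      fin_cases i <;> simp [com, hc, smul_mul_assoc, mul_smul_comm] <;> module
  rw [cross, this]
  module

theorem cubic_self (N : QuadraticForm ℂ A) (h : IsComposition N) [IsScalarTower ℂ A A]
    [SMulCommClass ℂ A A] (P : Herm3 A) : cubic N P P P = 4 * det N P := by
  rw [cubic, cross_self]
  have e0 := polar_mul_conj N h (P.2 0) (P.2 1) (P.2 2)
  have e2 := polar_conj_mul N h (P.2 2) (P.2 1) (P.2 0)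
  simp [pairing, traceForm, det, com, Fin.sum_univ_three, QuadraticMap.polar_sub_left,
    QuadraticMap.polar_smul_left]
  rw [QuadraticMap.polar_comm] at e0 e2
  rw [e0, e2]
  ring

/-- `𝔰𝔩₃(A)`: the linear endomorphisms of `𝒥₃(A)` that preserve the determinant
infinitesimally. -/
def sl3 (N : QuadraticForm ℂ A) : Set (Module.End ℂ (Herm3 A)) :=
  {D | ∀ r, cubic N (D r) r r = 0}

/-! ### Zorn matrices and the group `Sp₆(A)` -/

/-- Zorn matrices `𝒵₂(A) = ℂ ⊕ W ⊕ W* ⊕ ℂ*`: the element `(α, r, s, β)` is the matrix with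
scalars `α, β` on the diagonal and `r, s ∈ 𝒥₃(A)` off the diagonal. -/
abbrev Zorn (A : Type*) : Type _ := ℂ × Herm3 A × Herm3 A × ℂ

/-- The Lie algebra `𝔰𝔭₆(A) = (𝔰𝔩₃(A) ⊕ ℂ) ⊕ W ⊕ W*` of endomorphisms of `𝒵₂(A)`. An element is
the sum of the actions of `D ∈ 𝔰𝔩₃(A)`, acting by `0`, `D`, the contragredient `D'` of `D` and `0`
on the four summands, of a central element `c ∈ ℂ`, acting by
`-3c/2`, `-c/2`, `c/2`, `3c/2`, of `t ∈ W`, acting by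
`(α, r, s, β) ↦ (0, 3αt, C(rt), ½⟨t, s⟩)`, and of `u ∈ W*`, acting by
`(α, r, s, β) ↦ (½⟨r, u⟩, C*(su), 3βu, 0)`. -/
def sp6 (N : QuadraticForm ℂ A) : Set (Module.End ℂ (Zorn A)) :=
  {X | ∃ D ∈ sl3 N, ∃ D' : Module.End ℂ (Herm3 A),
      (∀ r s, pairing N (D r) s + pairing N r (D' s) = 0) ∧
      ∃ (c : ℂ) (t u : Herm3 A), ∀ (α : ℂ) (r s : Herm3 A) (β : ℂ),
        X (α, r, s, β) =
          (-(3 / 2 * c) * α + 1 / 2 * pairing N r u,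
           D r - (1 / 2 * c) • r + (3 * α) • t + cross N s u,
           D' s + (1 / 2 * c) • s + cross N r t + (3 * β) • u,
           3 / 2 * c * β + 1 / 2 * pairing N t s)}

end Algebra

section Linear

variable {V : Type*} [AddCommGroup V] [Module ℂ V]

/-- The exponential `∑ Xⁿ / n!` of an endomorphism of a finite-dimensional complex vector space,
computed in matrices. -/
noncomputable def endExp [FiniteDimensional ℂ V] (X : Module.End ℂ V) : Module.End ℂ V :=
  let b := Module.finBasis ℂ V
  Matrix.toLin b b (NormedSpace.exp (LinearMap.toMatrix b b X))

/-- `F` is a polynomial function on `V`: a polynomial in linear forms. -/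
def IsPolynomial (F : V → ℂ) : Prop :=
  ∃ p : MvPolynomial (Module.Dual ℂ V) ℂ, ∀ v, F v = p.eval fun φ => φ v

/-- `F` is a homogeneous polynomial function of degree `d` on `V`. -/
def IsHomogeneousPolynomial (d : ℕ) (F : V → ℂ) : Prop :=
  ∃ p : MvPolynomial (Module.Dual ℂ V) ℂ, p.IsHomogeneous d ∧ ∀ v, F v = p.eval fun φ => φ v

end Linear

section Main

variable {A : Type*} [NonAssocRing A] [Module ℂ A]

/-- `Sp₆(A) ⊆ GL(𝒵₂(A))`: the connected group with Lie algebra `𝔰𝔭₆(A)`, that is, the group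
generated by the exponentials of the elements of `𝔰𝔭₆(A)`. -/
noncomputable def Sp6 [FiniteDimensional ℂ A] (N : QuadraticForm ℂ A) :
    Subgroup (LinearMap.GeneralLinearGroup ℂ (Zorn A)) :=
  Subgroup.closure {g | ∃ X ∈ sp6 N, (g : Module.End ℂ (Zorn A)) = endExp X}

/-- `F` is invariant under `Sp₆(A)`. -/
def IsInvariant [FiniteDimensional ℂ A] (N : QuadraticForm ℂ A) (F : Zorn A → ℂ) : Prop :=
  ∀ g ∈ Sp6 N, ∀ v, F ((g : Module.End ℂ (Zorn A)) v) = F v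

/-- The quartic form
`Q = (3αβ - ½⟨r, s⟩)² + ⅓ (β C(r³) + α C*(s³)) - ⅙ ⟨C*(s²), C(r²)⟩` on `𝒵₂(A)`. -/
noncomputable def quartic (N : QuadraticForm ℂ A) : Zorn A → ℂ := fun (α, r, s, β) =>
  (3 * α * β - 1 / 2 * pairing N r s) ^ 2
    + 1 / 3 * (β * cubic N r r r + α * cubic N s s s)
    - 1 / 6 * pairing N (cross N s s) (cross N r r)

/-- The homothety `a I` in `𝒥₃(A)`. -/
def homothety (a : ℂ) : Herm3 A := (fun _ => a, 0)

/-- The inclusion of the space of binary cubics in `𝒵₂(A)`, with image the space `Δ_𝒵` of Zorn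
matrices whose entries in `𝒥₃(A)` are homotheties: the cubic
`p₀ x³ + p₁ x² y + p₂ x y² + p₃ y³` is the Zorn matrix `(p₀, p₁ I, p₂ I, p₃)`. -/
def ofCubic (P : Cubic ℂ) : Zorn A := (P.a, homothety P.b, homothety P.c, P.d)

end Main

/-- `Δ_𝒵 ⊆ 𝒵₂(A)`. -/
def deltaZ (A : Type*) [NonAssocRing A] : Set (Zorn A) :=
  {v | ∃ a b : ℂ, v.2.1 = homothety a ∧ v.2.2.1 = homothety b}

theorem range_ofCubic (A : Type*) [NonAssocRing A] : Set.range (ofCubic : Cubic ℂ → Zorn A) = deltaZ A := by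
  ext ⟨x, r, s, y⟩
  constructor
  · rintro ⟨P, h⟩
    simp only [ofCubic, Prod.mk.injEq] at h
    exact ⟨P.b, P.c, h.2.1.symm, h.2.2.1.symm⟩
  · rintro ⟨a, b, h1, h2⟩
    simp only at h1 h2
    exact ⟨⟨x, a, b, y⟩, by simp [ofCubic, h1, h2]⟩

/-- The discriminant of `p₀ x³ + p₁ x² y + p₂ x y² + p₃ y³`. -/
def classicalDiscriminant (P : Cubic ℂ) : ℂ :=
  3 * (3 * P.a * P.d - P.b * P.c) ^ 2 + 4 * (P.a * P.c ^ 3 + P.b ^ 3 * P.d)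
    - 4 * P.b ^ 2 * P.c ^ 2

/-- Up to the sign convention this is the discriminant of Mathlib. -/
theorem classicalDiscriminant_eq (P : Cubic ℂ) : classicalDiscriminant P = -P.discr := by
  simp only [classicalDiscriminant, Cubic.discr]
  ring

/-- Cayley's hyperdeterminant of a `2 × 2 × 2` array. -/
def hyperdeterminant (a : Fin 2 → Fin 2 → Fin 2 → ℂ) : ℂ :=
  a 0 0 0 ^ 2 * a 1 1 1 ^ 2 + a 1 0 0 ^ 2 * a 0 1 1 ^ 2
    + a 0 1 0 ^ 2 * a 1 0 1 ^ 2 + a 0 0 1 ^ 2 * a 1 1 0 ^ 2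
    - 2 * (a 0 0 0 * a 1 1 1 * a 1 0 0 * a 0 1 1 + a 0 0 0 * a 1 1 1 * a 0 1 0 * a 1 0 1
      + a 0 0 0 * a 1 1 1 * a 0 0 1 * a 1 1 0 + a 1 0 0 * a 0 1 1 * a 0 1 0 * a 1 0 1
      + a 1 0 0 * a 0 1 1 * a 0 0 1 * a 1 1 0 + a 0 1 0 * a 1 0 1 * a 0 0 1 * a 1 1 0)
    + 4 * (a 0 0 0 * a 0 1 1 * a 1 0 1 * a 1 1 0 + a 1 1 1 * a 1 0 0 * a 0 1 0 * a 0 0 1)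

/-- The `2 × 2 × 2` array that corresponds to the Zorn matrix `(α, diag r, diag s, β)` in
`𝒵₂(0) = ℂ² ⊗ ℂ² ⊗ ℂ²`. -/
def toArray (α : ℂ) (r s : Fin 3 → ℂ) (β : ℂ) : Fin 2 → Fin 2 → Fin 2 → ℂ :=
  ![![![3 * α, r 2], ![r 1, s 0]], ![![r 0, s 1], ![s 2, 3 * β]]]

end Freudenthal

/-!
Infinitesimal invariance of the quartic form `Q` comes down to Springer's adjoint identity
`com (com r) = det r • r` (`com_com`), which holds over every composition algebra by the
alternative laws and a middle Moufang identity. Its first polarization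
(`two_smul_cross_cross`) is what the summands `W` and `W*` of `𝔰𝔭₆(A)` need in order to kill `Q`;
it also shows that the contragredient of an element of `𝔰𝔩₃(A)` preserves the cubic form
(`IsContragredient.mem_sl3`), so that `𝔰𝔩₃(A)` kills each term of `Q`. Integrating along
`z ↦ exp (zX) v` gives the invariance under the group (`isInvariant_quartic`).

For the uniqueness it is enough that an invariant polynomial `F` that vanishes on the binary
cubics is zero (`IsInvariant.eq_zero`). Differentiating the invariance under the exponentials,
`F` is constant along every integral curve of an element of `𝔰𝔭₆(A)`
(`IsInvariant.eq_of_flow`), so no exponential has to be computed. If `β ≠ 0`, the flow of a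
suitable `u ∈ W*` moves `(α, r, s, β)` to an element `(α', r', 0, β)`; Gaussian elimination
by three families of nilpotent elements of `𝔰𝔩₃(A)` makes `r'` diagonal, and the torus of `𝔰𝔩₃(A)`
makes a diagonal matrix with nonzero entries a homothety (`IsInvariant.eq_homothety`). The
pivots are nonzero off a hypersurface, and a polynomial that vanishes off a hypersurface is zero.

The restrictions of `Q` to the binary cubics and to the diagonal matrices are direct computations.

The algebra `A` carries no topology: curves in vector spaces are differentiated through linear
forms (`HasWeakDerivAt`).
-/

set_option linter.unusedSectionVars false

namespace Freudenthal

open Module QuadraticMap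

/-! ### Polynomial maps and derivatives of curves, read off by linear forms -/

section Calculus

variable {V W U : Type*} [AddCommGroup V] [Module ℂ V] [AddCommGroup W] [Module ℂ W]
  [AddCommGroup U] [Module ℂ U]

/-- A vector-valued map all of whose linear forms are homogeneous polynomial functions of
degree `d`. -/
def IsHomogeneousMap (d : ℕ) (G : V → W) : Prop :=
  ∀ φ : Dual ℂ W, IsHomogeneousPolynomial d fun v => φ (G v)

theorem IsHomogeneousPolynomial.isPolynomial {d : ℕ} {F : V → ℂ}
    (hF : IsHomogeneousPolynomial d F) : IsPolynomial F := by
  obtain ⟨p, -, hp⟩ := hF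
  exact ⟨p, hp⟩

theorem IsPolynomial.sub_const_mul {F G : V → ℂ} (hF : IsPolynomial F) (hG : IsPolynomial G)
    (c : ℂ) : IsPolynomial fun v => F v - c * G v := by
  obtain ⟨p, hp⟩ := hF
  obtain ⟨q, hq⟩ := hG
  exact ⟨p - MvPolynomial.C c * q, fun v => by simp [hp, hq]⟩

theorem IsHomogeneousPolynomial.add {d : ℕ} {F G : V → ℂ} (hF : IsHomogeneousPolynomial d F)
    (hG : IsHomogeneousPolynomial d G) : IsHomogeneousPolynomial d fun v => F v + G v := by
  obtain ⟨p, hp, hpF⟩ := hF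
  obtain ⟨q, hq, hqG⟩ := hG
  exact ⟨p + q, hp.add hq, fun v => by simp [hpF, hqG]⟩

theorem IsHomogeneousPolynomial.mul {d e : ℕ} {F G : V → ℂ} (hF : IsHomogeneousPolynomial d F)
    (hG : IsHomogeneousPolynomial e G) : IsHomogeneousPolynomial (d + e) fun v => F v * G v := by
  obtain ⟨p, hp, hpF⟩ := hF
  obtain ⟨q, hq, hqG⟩ := hG
  exact ⟨p * q, hp.mul hq, fun v => by simp [hpF, hqG]⟩

theorem IsHomogeneousPolynomial.const_mul {d : ℕ} {F : V → ℂ} (c : ℂ)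
    (hF : IsHomogeneousPolynomial d F) : IsHomogeneousPolynomial d fun v => c * F v := by
  obtain ⟨p, hp, hpF⟩ := hF
  exact ⟨MvPolynomial.C c * p, hp.C_mul c, fun v => by simp [hpF]⟩

theorem IsHomogeneousPolynomial.sum {ι : Type*} (s : Finset ι) {d : ℕ} {F : ι → V → ℂ}
    (hF : ∀ i, IsHomogeneousPolynomial d (F i)) :
    IsHomogeneousPolynomial d fun v => ∑ i ∈ s, F i v := by
  choose p hp hpF using hF
  exact ⟨∑ i ∈ s, p i, MvPolynomial.IsHomogeneous.sum _ _ _ fun i _ => hp i,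
    fun v => by simp [hpF]⟩

theorem isHomogeneousMap_linear (f : V →ₗ[ℂ] W) : IsHomogeneousMap 1 f := fun φ =>
  ⟨MvPolynomial.X (φ ∘ₗ f), MvPolynomial.isHomogeneous_X _ _, fun v => by simp⟩

/-- The values of a bilinear map, expanded in a basis of the first factor. -/
theorem bilin_apply_eq_sum [FiniteDimensional ℂ V] (B : V →ₗ[ℂ] W →ₗ[ℂ] U) (φ : Dual ℂ U)
    (v : V) (w : W) :
    φ (B v w) = ∑ i, (finBasis ℂ V).coord i v * (φ ∘ₗ B (finBasis ℂ V i)) w := by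
  conv_lhs => rw [← (finBasis ℂ V).sum_repr v]
  simp only [map_sum, map_smul, LinearMap.sum_apply, LinearMap.smul_apply, smul_eq_mul,
    Basis.coord_apply, LinearMap.comp_apply]

theorem IsHomogeneousMap.bilin {V₀ : Type*} [AddCommGroup V₀] [Module ℂ V₀]
    [FiniteDimensional ℂ V] (B : V →ₗ[ℂ] W →ₗ[ℂ] U) {d e : ℕ} {F : V₀ → V} {G : V₀ → W}
    (hF : IsHomogeneousMap d F) (hG : IsHomogeneousMap e G) :
    IsHomogeneousMap (d + e) fun v => B (F v) (G v) := by
  intro φ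
  simp_rw [bilin_apply_eq_sum B φ]
  exact .sum _ fun i => (hF _).mul (hG _)

/-- The curve `w` has derivative `w'` at `z`, tested on linear forms: no topology on the vector
space is needed. -/
def HasWeakDerivAt (w : ℂ → V) (w' : V) (z : ℂ) : Prop :=
  ∀ φ : Dual ℂ V, HasDerivAt (fun z => φ (w z)) (φ w') z

theorem HasWeakDerivAt.linear {w : ℂ → V} {w' : V} {z : ℂ} (hw : HasWeakDerivAt w w' z)
    (f : V →ₗ[ℂ] W) : HasWeakDerivAt (fun z => f (w z)) (f w') z :=
  fun φ => hw (φ ∘ₗ f)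

theorem HasWeakDerivAt.hasDerivAt {w : ℂ → ℂ} {w' z : ℂ} (hw : HasWeakDerivAt w w' z) :
    HasDerivAt w w' z :=
  hw LinearMap.id

theorem HasWeakDerivAt.add {v w : ℂ → V} {v' w' : V} {z : ℂ} (hv : HasWeakDerivAt v v' z)
    (hw : HasWeakDerivAt w w' z) : HasWeakDerivAt (fun z => v z + w z) (v' + w') z := by
  intro φ
  simpa using (hv φ).fun_add (hw φ)

theorem HasWeakDerivAt.sum {ι : Type*} (s : Finset ι) {w : ι → ℂ → V} {w' : ι → V} {z : ℂ}
    (hw : ∀ i, HasWeakDerivAt (w i) (w' i) z) :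
    HasWeakDerivAt (fun z => ∑ i ∈ s, w i z) (∑ i ∈ s, w' i) z := by
  intro φ
  simpa using HasDerivAt.fun_sum fun i (_ : i ∈ s) => hw i φ

theorem hasWeakDerivAt_smul {f : ℂ → ℂ} {f' z : ℂ} (hf : HasDerivAt f f' z) (v : V) :
    HasWeakDerivAt (fun z => f z • v) (f' • v) z := by
  intro φ
  simpa using hf.mul_const (φ v)

/-- The product rule. -/
theorem HasWeakDerivAt.bilin [FiniteDimensional ℂ V] (B : V →ₗ[ℂ] W →ₗ[ℂ] U) {v : ℂ → V}
    {w : ℂ → W} {v' : V} {w' : W} {z : ℂ} (hv : HasWeakDerivAt v v' z)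
    (hw : HasWeakDerivAt w w' z) :
    HasWeakDerivAt (fun z => B (v z) (w z)) (B v' (w z) + B (v z) w') z := by
  intro φ
  simp_rw [map_add, bilin_apply_eq_sum B φ, ← Finset.sum_add_distrib]
  exact HasDerivAt.fun_sum fun i _ => (hv _).fun_mul (hw _)

/-- The derivative at `v` in direction `u` of the polynomial function of `p`. -/
noncomputable def polyDeriv (p : MvPolynomial (Dual ℂ V) ℂ) (v u : V) : ℂ :=
  MvPolynomial.eval (fun φ : Dual ℂ V => φ v)
    (MvPolynomial.mkDerivation ℂ (fun φ : Dual ℂ V => MvPolynomial.C (φ u)) p)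

/-- The chain rule. -/
theorem HasWeakDerivAt.polynomial {w : ℂ → V} {w' : V} {z : ℂ} (hw : HasWeakDerivAt w w' z)
    (p : MvPolynomial (Dual ℂ V) ℂ) :
    HasDerivAt (fun z => p.eval fun φ => φ (w z)) (polyDeriv p (w z) w') z := by
  induction p using MvPolynomial.induction_on with
  | C a => simpa [polyDeriv, MvPolynomial.derivation_C] using hasDerivAt_const z a
  | add p q hp hq => simpa [polyDeriv] using hp.fun_add hq
  | mul_X p φ hp =>
    simp only [map_mul, MvPolynomial.eval_X]
    refine (hp.fun_mul (hw φ)).congr_deriv ?_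
    simp [polyDeriv, Derivation.leibniz, MvPolynomial.mkDerivation_X]
    ring

section Exponential

variable [FiniteDimensional ℂ V]

open scoped Matrix.Norms.Operator in
theorem hasWeakDerivAt_endExp (X : End ℂ V) (v : V) (z : ℂ) :
    HasWeakDerivAt (fun z : ℂ => endExp (z • X) v) (X (endExp (z • X) v)) z := by
  intro φ
  set b := finBasis ℂ V
  set M := LinearMap.toMatrix b b X with hM
  let ψ : Matrix (Fin (finrank ℂ V)) (Fin (finrank ℂ V)) ℂ →ₗ[ℂ] ℂ :=
    φ ∘ₗ LinearMap.applyₗ v ∘ₗ (Matrix.toLin b b).toLinearMap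
  have h := hasDerivAt_exp_smul_const' (𝕂 := ℂ) M z
  have h2 := (LinearMap.toContinuousLinearMap ψ).hasFDerivAt.comp_hasDerivAt z h
  have e : ∀ z : ℂ, ψ (NormedSpace.exp (z • M)) = φ (endExp (z • X) v) := fun z => by
    simp [endExp, ψ, b, M]
  have e' : ψ (M * NormedSpace.exp (z • M)) = φ (X (endExp (z • X) v)) := by
    simp only [ψ, LinearMap.comp_apply, LinearEquiv.coe_coe, Matrix.toLin_mul b b b,
      LinearMap.applyₗ_apply_apply, hM, Matrix.toLin_toMatrix, endExp, map_smul]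
    rfl
  rw [← e']
  exact h2.congr_of_eventuallyEq (.of_forall fun z => (e z).symm)

theorem endExp_zero : endExp (0 : End ℂ V) = 1 := by
  simp [endExp, Module.End.one_eq_id]

theorem isUnit_endExp (X : End ℂ V) : IsUnit (endExp X) := by
  have := (Matrix.isUnit_exp (LinearMap.toMatrix (finBasis ℂ V) (finBasis ℂ V) X)).map
    (Matrix.toLinAlgEquiv (finBasis ℂ V))
  exact this

end Exponential

/-- A function with zero derivative along `w` has the same value at the ends of `w`. -/
theorem eq_of_forall_hasDerivAt_zero {f : ℂ → ℂ} (h : ∀ z, HasDerivAt f 0 z) (a b : ℂ) :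
    f a = f b :=
  is_const_of_deriv_eq_zero (fun z => (h z).differentiableAt) (fun z => (h z).deriv) a b

end Calculus

section Composition

variable {A : Type*} [NonAssocRing A] [Module ℂ A] [IsScalarTower ℂ A A] [SMulCommClass ℂ A A]
  {N : QuadraticForm ℂ A}

/-! ### Composition algebras -/

theorem IsComposition.ext (h : IsComposition N) {x y : A} (hxy : ∀ w, polar N x w = polar N y w) :
    x = y :=
  sub_eq_zero.1 <| h.nondegenerate _ fun w => by rw [polar_sub_left, hxy, sub_self]

theorem map_sub_eq (N : QuadraticForm ℂ A) (x y : A) : N (x - y) = N x + N y - polar N x y := by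
  have : N (x + -y) = N x + N (-y) + polar N x (-y) := by
    simp only [polar]
    ring
  rw [sub_eq_add_neg, this, QuadraticMap.map_neg, polar_neg_right]
  ring

theorem polar_mul_mul_left (h : IsComposition N) (a b c : A) :
    polar N (c * a) (c * b) = N c * polar N a b := by
  simp only [polar, ← mul_add, h.map_mul]
  ring

theorem polar_mul_mul_right (h : IsComposition N) (a b c : A) :
    polar N (a * c) (b * c) = polar N a b * N c := by
  simp only [polar, ← add_mul, h.map_mul]
  ring

/-- The polarized composition law. -/
theorem polar_mul_add_polar_mul (h : IsComposition N) (u v x y : A) :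
    polar N (u * x) (v * y) + polar N (v * x) (u * y) = polar N u v * polar N x y := by
  have e := polar_mul_mul_left h x y (u + v)
  have e1 := polar_mul_mul_left h x y u
  have e2 := polar_mul_mul_left h x y v
  have e3 : N (u + v) = polar N u v + N u + N v := by
    simp only [polar]
    ring
  rw [e3] at e
  simp only [add_mul, polar_add_left, polar_add_right] at e
  linear_combination e - e1 - e2

theorem polar_one_mul_polar_one_one (h : IsComposition N) (x : A) :
    polar N x 1 * polar N (1 : A) 1 = 2 * polar N x 1 := by
  have e := polar_mul_mul_right h x 1 1
  rw [mul_one, mul_one] at e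
  rw [polar_self]
  linear_combination -2 * e

theorem conj_conj (h : IsComposition N) (x : A) : conj N (conj N x) = x := by
  simp only [conj, polar_sub_left, polar_smul_left, smul_eq_mul, polar_one_mul_polar_one_one h]
  module

theorem polar_conj_right (h : IsComposition N) (x z : A) :
    polar N x (conj N z) = polar N (x * z) 1 := by
  simpa using polar_mul_conj N h x 1 z

theorem polar_conj_right' (h : IsComposition N) (x z : A) :
    polar N x (conj N z) = polar N (z * x) 1 := by
  simpa using polar_conj_mul N h x 1 z

theorem map_conj (h : IsComposition N) (x : A) : N (conj N x) = N x := by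
  have h1 : polar N x 1 * N 1 = polar N x 1 := by
    have e := polar_mul_mul_right h x 1 1
    rw [mul_one, mul_one] at e
    exact e.symm
  rw [conj, map_sub_eq, QuadraticMap.map_smul, polar_smul_left, polar_comm N 1 x]
  simp only [smul_eq_mul]
  linear_combination polar N x 1 * h1

theorem conj_mul (h : IsComposition N) (x y : A) :
    conj N (x * y) = conj N y * conj N x := by
  refine h.ext fun w => ?_
  rw [polar_comm, polar_conj_right' h, ← polar_conj_right h (x * y) w, ← polar_mul_conj N h,
    polar_conj_mul N h, ← polar_mul_conj N h, polar_comm]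

theorem conj_mul_mul (h : IsComposition N) (z y : A) : conj N z * (z * y) = N z • y := by
  refine h.ext fun w => ?_
  rw [polar_comm, polar_conj_mul N h, polar_mul_mul_left h, polar_smul_left, polar_comm N w y,
    smul_eq_mul]

theorem mul_mul_conj (h : IsComposition N) (y z : A) : y * z * conj N z = N z • y := by
  refine h.ext fun w => ?_
  rw [polar_comm, polar_mul_conj N h, polar_mul_mul_right h, polar_smul_left, polar_comm N w y,
    smul_eq_mul, mul_comm]

theorem mul_conj_mul (h : IsComposition N) (z y : A) : z * (conj N z * y) = N z • y := by
  have e := conj_mul_mul h (conj N z) y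
  rwa [conj_conj h, map_conj h] at e

/-- A form of the middle Moufang identity `(ab)(ca) = a(bc)a`. -/
theorem mul_mul_mul_self (h : IsComposition N) (a b c : A) :
    a * b * (c * a) = polar N a (conj N (b * c)) • a - N a • conj N (b * c) := by
  refine h.ext fun w => ?_
  have e1 := polar_mul_conj N h (a * b) w (c * a)
  have e2 := polar_mul_add_polar_mul h a w b (conj N a * conj N c)
  have e3 : polar N (w * b) (conj N c) = polar N w (conj N c * conj N b) :=
    (polar_mul_conj N h w (conj N c) b).symm
  have e4 : polar N b (conj N a * conj N c) = polar N a (conj N c * conj N b) := by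
    rw [polar_conj_mul N h, polar_mul_conj N h]
  rw [conj_mul h] at e1
  rw [mul_conj_mul h, polar_smul_right, smul_eq_mul, e3, e4] at e2
  rw [conj_mul h, polar_sub_left, polar_smul_left, polar_smul_left, smul_eq_mul, smul_eq_mul,
    polar_comm N (conj N c * conj N b) w]
  linear_combination -e1 + e2

/-! ### The comatrix, the pairing and the cubic form -/

theorem conj_add (N : QuadraticForm ℂ A) (x y : A) : conj N (x + y) = conj N x + conj N y := by
  simp only [conj, polar_add_left]
  module

theorem polar_conj_conj (h : IsComposition N) (x y : A) :
    polar N (conj N x) (conj N y) = polar N x y := by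
  simp only [polar, ← conj_add, map_conj h]

theorem conj_smul (N : QuadraticForm ℂ A) (a : ℂ) (x : A) : conj N (a • x) = a • conj N x := by
  simp only [conj, polar_smul_left, smul_eq_mul]
  module

theorem conj_sub (N : QuadraticForm ℂ A) (x y : A) : conj N (x - y) = conj N x - conj N y := by
  simp only [conj, polar_sub_left]
  module

@[simp]
theorem conj_zero (N : QuadraticForm ℂ A) : conj N (0 : A) = 0 := by
  simp [conj]

theorem cross_eq (N : QuadraticForm ℂ A) (P R : Herm3 A) :
    cross N P R =
      (![P.1 1 * R.1 2 + P.1 2 * R.1 1 - polar N (P.2 0) (R.2 0),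
         P.1 2 * R.1 0 + P.1 0 * R.1 2 - polar N (P.2 1) (R.2 1),
         P.1 0 * R.1 1 + P.1 1 * R.1 0 - polar N (P.2 2) (R.2 2)],
       ![P.2 1 * conj N (R.2 2) + R.2 1 * conj N (P.2 2) - P.1 0 • R.2 0 - R.1 0 • P.2 0,
         P.2 0 * R.2 2 + R.2 0 * P.2 2 - P.1 1 • R.2 1 - R.1 1 • P.2 1,
         conj N (P.2 0) * R.2 1 + conj N (R.2 0) * P.2 1 - P.1 2 • R.2 2 - R.1 2 • P.2 2]) := by
  refine Prod.ext ?_ ?_ <;> funext i <;> fin_cases i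
  · simp [cross, com, polar]; ring
  · simp [cross, com, polar]; ring
  · simp [cross, com, polar]; ring
  · simp [cross, com, conj_add, add_mul, mul_add]; module
  · simp [cross, com, conj_add, add_mul, mul_add]; module
  · simp [cross, com, conj_add, add_mul, mul_add]; module

theorem cross_comm (N : QuadraticForm ℂ A) (P R : Herm3 A) : cross N P R = cross N R P := by
  rw [cross, cross, add_comm P R]
  abel

theorem cross_add_left (N : QuadraticForm ℂ A) (P Q R : Herm3 A) :
    cross N (P + Q) R = cross N P R + cross N Q R := by
  simp only [cross_eq]
  refine Prod.ext ?_ ?_ <;> funext i <;> fin_cases i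
  · simp [polar_add_left]; ring
  · simp [polar_add_left]; ring
  · simp [polar_add_left]; ring
  · simp [conj_add, add_mul, mul_add]; module
  · simp [conj_add, add_mul, mul_add]; module
  · simp [conj_add, add_mul, mul_add]; module

theorem cross_smul_left (N : QuadraticForm ℂ A) (a : ℂ) (P R : Herm3 A) :
    cross N (a • P) R = a • cross N P R := by
  simp only [cross_eq]
  refine Prod.ext ?_ ?_ <;> funext i <;> fin_cases i
  · simp [polar_smul_left]; ring
  · simp [polar_smul_left]; ring
  · simp [polar_smul_left]; ring
  · simp [conj_smul, smul_mul_assoc, mul_smul_comm]; module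
  · simp [conj_smul, smul_mul_assoc, mul_smul_comm]; module
  · simp [conj_smul, smul_mul_assoc, mul_smul_comm]; module

/-- The product `cross` as a bilinear map. -/
def crossBilin (N : QuadraticForm ℂ A) : Herm3 A →ₗ[ℂ] Herm3 A →ₗ[ℂ] Herm3 A :=
  LinearMap.mk₂ ℂ (cross N) (cross_add_left N) (cross_smul_left N)
    (fun P Q R => by rw [cross_comm, cross_add_left, cross_comm N Q, cross_comm N R])
    (fun a P R => by rw [cross_comm, cross_smul_left, cross_comm N R])

theorem pairing_comm (N : QuadraticForm ℂ A) (P R : Herm3 A) : pairing N P R = pairing N R P := by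
  simp only [pairing, traceForm, mul_comm (P.1 _), polar_comm N (P.2 _)]

/-- The pairing as a bilinear form. -/
noncomputable def pairingBilin (N : QuadraticForm ℂ A) : LinearMap.BilinForm ℂ (Herm3 A) :=
  LinearMap.mk₂ ℂ (pairing N)
    (fun P Q R => by
      simp [pairing, traceForm, Fin.sum_univ_three, polar_add_left]; ring)
    (fun a P R => by
      simp [pairing, traceForm, Fin.sum_univ_three, polar_smul_left]; ring)
    (fun P Q R => by
      simp [pairing, traceForm, Fin.sum_univ_three, polar_add_right]; ring)
    (fun a P R => by
      simp [pairing, traceForm, Fin.sum_univ_three, polar_smul_right]; ring)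

@[simp]
theorem pairingBilin_apply (N : QuadraticForm ℂ A) (P R : Herm3 A) :
    pairingBilin N P R = pairing N P R := rfl

theorem pairing_ext (h : IsComposition N) {P R : Herm3 A}
    (hPR : ∀ S, pairing N P S = pairing N R S) : P = R := by
  refine Prod.ext ?_ ?_
  · funext i
    have := hPR (Pi.single i 1, 0)
    simpa [pairing, traceForm, Pi.single_apply] using this
  · funext i
    refine h.ext fun w => ?_
    have := hPR (0, Pi.single i w)
    fin_cases i <;> simpa [pairing, traceForm, Fin.sum_univ_three] using this

theorem cubic_comm_left (N : QuadraticForm ℂ A) (r s t : Herm3 A) :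
    cubic N r s t = cubic N s r t := by
  rw [cubic, cubic, cross_comm]

theorem cubic_comm_right (h : IsComposition N) (r s t : Herm3 A) :
    cubic N r s t = cubic N r t s := by
  have e0 : ∀ x y z : A, polar N (y * conj N z) x = polar N (x * z) y := fun x y z => by
    rw [polar_comm, polar_mul_conj N h]
  have e2 : ∀ x y z : A, polar N (conj N z * y) x = polar N (z * x) y := fun x y z => by
    rw [polar_comm, polar_conj_mul N h]
  simp only [cubic, cross_eq, pairing, traceForm, Fin.sum_univ_three]
  simp [polar_sub_left, polar_add_left, polar_smul_left, e0, e2]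
  rw [polar_comm N (t.2 0) (s.2 0), polar_comm N (t.2 1) (s.2 1), polar_comm N (t.2 2) (s.2 2)]
  ring

/-- The adjoint identity. The diagonal entries follow from the composition law, the others from
the alternative laws and the middle Moufang identity. -/
theorem com_com (h : IsComposition N) (r : Herm3 A) : com N (com N r) = det N r • r := by
  obtain ⟨a, x⟩ := r
  have e0 : polar N (x 1 * conj N (x 2)) (x 0) = polar N (x 0 * x 2) (x 1) := by
    rw [polar_comm, polar_mul_conj N h]
  have e2 : polar N (conj N (x 0) * x 1) (x 2) = polar N (x 0 * x 2) (x 1) := by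
    rw [polar_comm, polar_conj_mul N h]
  refine Prod.ext ?_ ?_ <;> funext i <;> fin_cases i
  · simp [com, det, map_sub_eq, h.map_mul, map_conj h, QuadraticMap.map_smul, polar_smul_right, e0]
    ring
  · simp [com, det, map_sub_eq, h.map_mul, map_conj h, QuadraticMap.map_smul, polar_smul_right]
    ring
  · simp [com, det, map_sub_eq, h.map_mul, map_conj h, QuadraticMap.map_smul, polar_smul_right, e2]
    ring
  · change (x 0 * x 2 - a 1 • x 1) * conj N (conj N (x 0) * x 1 - a 2 • x 2)
      - (a 1 * a 2 - N (x 0)) • (x 1 * conj N (x 2) - a 0 • x 0) = det N (a, x) • x 0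
    rw [det, ← e0, conj_sub, conj_smul, conj_mul h, conj_conj h]
    simp only [sub_mul, mul_sub, smul_mul_assoc, mul_smul_comm, mul_mul_mul_self h,
      mul_mul_conj h, mul_conj_mul h, conj_mul h, conj_conj h, polar_comm N (x 0)]
    module
  · change (x 1 * conj N (x 2) - a 0 • x 0) * (conj N (x 0) * x 1 - a 2 • x 2)
      - (a 2 * a 0 - N (x 1)) • (x 0 * x 2 - a 1 • x 1) = det N (a, x) • x 1
    have e3 := mul_mul_conj h (x 1) (conj N (x 2))
    rw [conj_conj h, map_conj h] at e3
    rw [det]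
    simp only [sub_mul, mul_sub, smul_mul_assoc, mul_smul_comm, mul_mul_mul_self h, e3,
      mul_conj_mul h, conj_mul h, conj_conj h, polar_comm N (x 1)]
    module
  · change conj N (x 1 * conj N (x 2) - a 0 • x 0) * (x 0 * x 2 - a 1 • x 1)
      - (a 0 * a 1 - N (x 2)) • (conj N (x 0) * x 1 - a 2 • x 2) = det N (a, x) • x 2
    have e3 := mul_mul_conj h (x 2) (conj N (x 1))
    rw [conj_conj h, map_conj h] at e3
    rw [det, ← e2, conj_sub, conj_smul, conj_mul h, conj_conj h]
    simp only [sub_mul, mul_sub, smul_mul_assoc, mul_smul_comm, mul_mul_mul_self h, e3,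
      conj_mul_mul h, conj_mul h, conj_conj h, polar_comm N (x 2)]
    module

end Composition

section Lines

variable {V : Type*} [AddCommGroup V] [Module ℂ V]

/-! ### Polynomial functions on lines -/

theorem IsPolynomial.exists_polynomial_line {F : V → ℂ} (hF : IsPolynomial F) (v u : V) :
    ∃ q : Polynomial ℂ, ∀ z : ℂ, F (v + z • u) = q.eval z := by
  obtain ⟨p, hp⟩ := hF
  refine ⟨MvPolynomial.aeval (fun φ : Dual ℂ V => Polynomial.C (φ v) + Polynomial.X *
    Polynomial.C (φ u)) p, fun z => ?_⟩
  rw [hp, ← Polynomial.coe_aeval_eq_eval, MvPolynomial.comp_aeval_apply,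
    ← MvPolynomial.coe_aeval_eq_eval]
  simp [MvPolynomial.aeval_def, mul_comm z]

/-- Polynomial functions have no zero divisors on a line. -/
theorem IsPolynomial.eq_zero_of_line {F G : V → ℂ} (hF : IsPolynomial F) (hG : IsPolynomial G)
    (v u : V) (h : ∀ z : ℂ, G (v + z • u) ≠ 0 → F (v + z • u) = 0) (z₀ : ℂ)
    (hz₀ : G (v + z₀ • u) ≠ 0) : F v = 0 := by
  obtain ⟨p, hp⟩ := hF.exists_polynomial_line v u
  obtain ⟨q, hq⟩ := hG.exists_polynomial_line v u
  have hpq : p * q = 0 := by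
    refine Polynomial.funext fun z => ?_
    rw [Polynomial.eval_mul, ← hp, ← hq, Polynomial.eval_zero, mul_eq_zero]
    exact or_iff_not_imp_right.2 (h z)
  have hq0 : q ≠ 0 := by
    rintro rfl
    exact hz₀ (by simp [hq])
  have := hp 0
  simpa [(mul_eq_zero.1 hpq).resolve_right hq0] using this

theorem isPolynomial_linear (φ : Dual ℂ V) : IsPolynomial φ :=
  ⟨MvPolynomial.X φ, fun v => by simp⟩

end Lines

section Cross

variable {A : Type*} [NonAssocRing A] [Module ℂ A] [IsScalarTower ℂ A A] [SMulCommClass ℂ A A]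
  {N : QuadraticForm ℂ A}

/-! ### Derivatives of the cubic form and the polarized adjoint identity -/

theorem HasWeakDerivAt.cross [FiniteDimensional ℂ A] {r s : ℂ → Herm3 A} {r' s' : Herm3 A}
    {z : ℂ} (hr : HasWeakDerivAt r r' z) (hs : HasWeakDerivAt s s' z) :
    HasWeakDerivAt (fun z => cross N (r z) (s z)) (cross N r' (s z) + cross N (r z) s') z :=
  hr.bilin (crossBilin N) hs

theorem HasWeakDerivAt.pairing [FiniteDimensional ℂ A] {r s : ℂ → Herm3 A} {r' s' : Herm3 A}
    {z : ℂ} (hr : HasWeakDerivAt r r' z) (hs : HasWeakDerivAt s s' z) :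
    HasDerivAt (fun z => pairing N (r z) (s z)) (pairing N r' (s z) + pairing N (r z) s') z :=
  (hr.bilin (pairingBilin N) hs).hasDerivAt

theorem pairing_add_left (N : QuadraticForm ℂ A) (r s t : Herm3 A) :
    pairing N (r + s) t = pairing N r t + pairing N s t :=
  (pairingBilin N).map_add₂ r s t

theorem pairing_add_right (N : QuadraticForm ℂ A) (r s t : Herm3 A) :
    pairing N r (s + t) = pairing N r s + pairing N r t :=
  (pairingBilin N r).map_add s t

theorem pairing_smul_left (N : QuadraticForm ℂ A) (a : ℂ) (r s : Herm3 A) :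
    pairing N (a • r) s = a * pairing N r s :=
  (pairingBilin N).map_smul₂ a r s

theorem pairing_smul_right (N : QuadraticForm ℂ A) (a : ℂ) (r s : Herm3 A) :
    pairing N r (a • s) = a * pairing N r s :=
  (pairingBilin N r).map_smul a s

theorem cross_smul_right (N : QuadraticForm ℂ A) (a : ℂ) (r s : Herm3 A) :
    cross N r (a • s) = a • cross N r s :=
  (crossBilin N r).map_smul a s

theorem cross_add_right (N : QuadraticForm ℂ A) (r s t : Herm3 A) :
    cross N r (s + t) = cross N r s + cross N r t :=
  (crossBilin N r).map_add s t

theorem pairing_cross_eq_cubic (r s t : Herm3 A) : pairing N (cross N r s) t = cubic N r s t :=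
  rfl

theorem cubic_rotate (h : IsComposition N) (r s t : Herm3 A) :
    cubic N t r s = cubic N r s t := by
  rw [cubic_comm_left, cubic_comm_right h]

theorem HasWeakDerivAt.cubic_self (h : IsComposition N) [FiniteDimensional ℂ A] {r : ℂ → Herm3 A}
    {r' : Herm3 A} {z : ℂ} (hr : HasWeakDerivAt r r' z) :
    HasDerivAt (fun z => cubic N (r z) (r z) (r z)) (3 * cubic N (r z) (r z) r') z := by
  refine ((hr.cross (N := N) hr).pairing (N := N) hr).congr_deriv ?_
  rw [pairing_add_left]
  simp only [pairing_cross_eq_cubic]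
  rw [cubic_rotate h, cubic_comm_right h (r z) r']
  ring

theorem hasWeakDerivAt_line {V : Type*} [AddCommGroup V] [Module ℂ V] (v u : V) (z : ℂ) :
    HasWeakDerivAt (fun z : ℂ => v + z • u) u z := by
  intro φ
  simpa using ((hasDerivAt_id z).mul_const (φ u)).const_add (φ v)

/-- The adjoint identity in terms of the product `cross`. -/
theorem cross_cross_self (h : IsComposition N) (r : Herm3 A) :
    cross N (cross N r r) (cross N r r) = (2 * cubic N r r r) • r := by
  rw [cubic_self N h, cross_self N r, cross_smul_left, cross_smul_right, cross_self, com_com h]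
  module

/-- The polarized adjoint identity, which is the derivative of the adjoint identity at `r` in
direction `t`. -/
theorem two_smul_cross_cross (h : IsComposition N) [FiniteDimensional ℂ A] (r t : Herm3 A) :
    (2 : ℂ) • cross N (cross N r t) (cross N r r)
      = (3 * cubic N r r t) • r + cubic N r r r • t := by
  refine pairing_ext h fun s => ?_
  have hr := hasWeakDerivAt_line r t 0
  have hc := (hr.cross (N := N) hr)
  have hs : HasWeakDerivAt (fun _ => s) 0 0 := by simpa using hasWeakDerivAt_line s 0 0
  have h1 := ((hc.cross (N := N) hc).pairing (N := N) hs)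
  have h2 := ((hr.cubic_self h).const_mul 2).fun_mul (hr.pairing (N := N) hs)
  have h3 := h1.unique (h2.congr_of_eventuallyEq (.of_forall fun z => by
    simp only [cross_cross_self h, pairing_smul_left]))
  have h0 : pairing N (cross N (cross N r r) (cross N r r)) 0 = 0 := (pairingBilin N _).map_zero
  have h0' : pairing N r 0 = 0 := (pairingBilin N _).map_zero
  simp only [zero_smul, add_zero, cross_comm N t r, cross_add_left, cross_add_right,
    cross_comm N (cross N r r) (cross N r t), pairing_add_left, h0, h0'] at h3
  simp only [pairing_add_left, pairing_smul_left]
  linear_combination h3 / 2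

/-! ### The Lie algebra `𝔰𝔩₃(A)` and contragredients -/

theorem sl3_polar (h : IsComposition N) [FiniteDimensional ℂ A] {D : End ℂ (Herm3 A)}
    (hD : D ∈ sl3 N) (r t : Herm3 A) :
    2 * cubic N r (D r) t + cubic N r r (D t) = 0 := by
  have hr := hasWeakDerivAt_line r t 0
  have h1 := (((hr.linear D).cross (N := N) hr).pairing (N := N) hr)
  have h2 := h1.unique ((hasDerivAt_const (0 : ℂ) (0 : ℂ)).congr_of_eventuallyEq
    (.of_forall fun z => hD _))
  simp only [zero_smul, add_zero, pairing_add_left, pairing_cross_eq_cubic] at h2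
  rw [cubic_rotate h r r, cubic_comm_right h (D r) t, cubic_comm_left N (D r) r] at h2
  linear_combination h2

/-- `D'` is contragredient to `D` for the pairing. -/
def IsContragredient (N : QuadraticForm ℂ A) (D D' : End ℂ (Herm3 A)) : Prop :=
  ∀ r s, pairing N (D r) s + pairing N r (D' s) = 0

theorem IsContragredient.symm {D D' : End ℂ (Herm3 A)} (h : IsContragredient N D D') :
    IsContragredient N D' D := fun r s => by
  rw [pairing_comm N _ s, pairing_comm N r, add_comm]
  exact h s r

/-- Contragredients exist because the pairing is nondegenerate. -/
theorem exists_isContragredient (h : IsComposition N) [FiniteDimensional ℂ A]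
    (D : End ℂ (Herm3 A)) : ∃ D', IsContragredient N D D' := by
  have hl : ∀ r, (∀ s, pairing N r s = 0) → r = 0 := fun r hr => pairing_ext h fun s =>
    (hr s).trans ((pairingBilin N).map_zero₂ s).symm
  have hnd : (pairingBilin N).Nondegenerate :=
    ⟨hl, fun s hs => hl s fun r => (pairing_comm N s r).trans (hs r)⟩
  refine ⟨-(pairingBilin N).leftAdjointOfNondegenerate hnd D, fun r s => ?_⟩
  have := LinearMap.BilinForm.isAdjointPairLeftAdjointOfNondegenerate (pairingBilin N) hnd D s r
  simp only [pairingBilin_apply] at this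
  rw [pairing_comm N r, LinearMap.neg_apply, ← neg_one_smul ℂ, pairing_smul_left, this,
    pairing_comm N s]
  ring

/-- `C(r²)` as a map from `W` to `W*` is equivariant under `𝔰𝔩₃(A)`, by polarization of
`C(Dr, r, r) = 0`. -/
theorem IsContragredient.apply_cross_self (h : IsComposition N) [FiniteDimensional ℂ A]
    {D D' : End ℂ (Herm3 A)} (hD : D ∈ sl3 N) (hDD' : IsContragredient N D D') (r : Herm3 A) :
    D' (cross N r r) = (2 : ℂ) • cross N r (D r) := by
  refine pairing_ext h fun t => ?_
  have h1 := hDD' t (cross N r r)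
  have h2 := sl3_polar h hD r t
  rw [pairing_comm N (D t), pairing_comm N t] at h1
  rw [pairing_smul_left]
  simp only [pairing_cross_eq_cubic] at h1 ⊢
  linear_combination h1 - h2

theorem isHomogeneousPolynomial_pairing [FiniteDimensional ℂ A] {V : Type*} [AddCommGroup V]
    [Module ℂ V] {d e : ℕ} {F G : V → Herm3 A} (hF : IsHomogeneousMap d F)
    (hG : IsHomogeneousMap e G) :
    IsHomogeneousPolynomial (d + e) fun v => pairing N (F v) (G v) :=
  hF.bilin (pairingBilin N) hG LinearMap.id

theorem IsHomogeneousMap.cross [FiniteDimensional ℂ A] {V : Type*} [AddCommGroup V]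
    [Module ℂ V] {d e : ℕ} {F G : V → Herm3 A} (hF : IsHomogeneousMap d F)
    (hG : IsHomogeneousMap e G) :
    IsHomogeneousMap (d + e) fun v => cross N (F v) (G v) :=
  hF.bilin (crossBilin N) hG

/-- The contragredient of an element of `𝔰𝔩₃(A)` is in `𝔰𝔩₃(A)`. By the adjoint identity this
holds at the elements `C(r²)`, and these contain a multiple of every `s` with `C(s³) ≠ 0`. -/
theorem IsContragredient.mem_sl3 (h : IsComposition N) [FiniteDimensional ℂ A]
    {D D' : End ℂ (Herm3 A)} (hD : D ∈ sl3 N) (hDD' : IsContragredient N D D') : D' ∈ sl3 N := by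
  have h1 : ∀ r, cubic N (D' (cross N r r)) (cross N r r) (cross N r r) = 0 := by
    intro r
    have h2 := hDD' r (cross N r r)
    have h3 := hD r
    rw [cubic_rotate h] at h3 ⊢
    rw [pairing_comm, pairing_cross_eq_cubic, h3, zero_add] at h2
    rw [cubic, cross_cross_self h, pairing_smul_left, h2, mul_zero]
  -- by the adjoint identity `s` is a multiple of the square of `cross N s s`
  have h2 : ∀ s, cubic N s s s ≠ 0 → cubic N (D' s) s s = 0 := by
    intro s hs
    have h3 := h1 (cross N s s)
    rw [cross_cross_self h, map_smul, cubic, cross_smul_left, cross_smul_right,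
      pairing_smul_left, pairing_smul_left, pairing_smul_right] at h3
    rw [cubic]
    exact (by simpa [hs] using h3 : cubic N s s s = 0 ∨ _).resolve_left hs
  intro s
  have hid : IsHomogeneousMap 1 fun s : Herm3 A => s := isHomogeneousMap_linear LinearMap.id
  refine IsPolynomial.eq_zero_of_line (F := fun s => cubic N (D' s) s s)
    (G := fun s => cubic N s s s)
    (isHomogeneousPolynomial_pairing ((isHomogeneousMap_linear D').cross hid) hid).isPolynomial
    (isHomogeneousPolynomial_pairing (hid.cross hid) hid).isPolynomial
    s (homothety 1 - s) (fun z => h2 _) 1 ?_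
  rw [one_smul, add_sub_cancel, cubic_self N h]
  simp [det, homothety]

end Cross

section Invariance

variable {A : Type*} [NonAssocRing A] [Module ℂ A] [IsScalarTower ℂ A A] [SMulCommClass ℂ A A]
  {N : QuadraticForm ℂ A}

/-! ### Invariance of the quartic form -/

theorem quartic_apply (N : QuadraticForm ℂ A) (v : Zorn A) :
    quartic N v = (3 * v.1 * v.2.2.2 - 1 / 2 * pairing N v.2.1 v.2.2.1) ^ 2
      + 1 / 3 * (v.2.2.2 * cubic N v.2.1 v.2.1 v.2.1 + v.1 * cubic N v.2.2.1 v.2.2.1 v.2.2.1)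
      - 1 / 6 * pairing N (cross N v.2.2.1 v.2.2.1) (cross N v.2.1 v.2.1) := rfl

theorem isHomogeneousPolynomial_quartic [FiniteDimensional ℂ A] (N : QuadraticForm ℂ A) :
    IsHomogeneousPolynomial 4 (quartic N) := by
  have hα : IsHomogeneousPolynomial 1 fun v : Zorn A => v.1 :=
    isHomogeneousMap_linear (LinearMap.fst ℂ ℂ (Herm3 A × Herm3 A × ℂ)) LinearMap.id
  have hr : IsHomogeneousMap 1 fun v : Zorn A => v.2.1 :=
    isHomogeneousMap_linear (LinearMap.fst ℂ _ _ ∘ₗ LinearMap.snd ℂ ℂ (Herm3 A × Herm3 A × ℂ))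
  have hs : IsHomogeneousMap 1 fun v : Zorn A => v.2.2.1 :=
    isHomogeneousMap_linear (LinearMap.fst ℂ _ _ ∘ₗ LinearMap.snd ℂ _ _ ∘ₗ
      LinearMap.snd ℂ ℂ (Herm3 A × Herm3 A × ℂ))
  have hβ : IsHomogeneousPolynomial 1 fun v : Zorn A => v.2.2.2 :=
    isHomogeneousMap_linear (LinearMap.snd ℂ _ _ ∘ₗ LinearMap.snd ℂ _ _ ∘ₗ
      LinearMap.snd ℂ ℂ (Herm3 A × Herm3 A × ℂ)) LinearMap.id
  have h1 := ((hα.mul hβ).const_mul 3).add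
    ((isHomogeneousPolynomial_pairing (N := N) hr hs).const_mul (-1 / 2))
  have h2 := (((hβ.mul (isHomogeneousPolynomial_pairing (N := N) (hr.cross (N := N) hr) hr)).add
    (hα.mul (isHomogeneousPolynomial_pairing (N := N) (hs.cross (N := N) hs) hs))).const_mul
      (1 / 3)).add ((isHomogeneousPolynomial_pairing (N := N) (hs.cross (N := N) hs)
        (hr.cross (N := N) hr)).const_mul (-1 / 6))
  obtain ⟨p, hp, hpe⟩ := (h1.mul h1).add h2
  refine ⟨p, hp, fun v => ?_⟩
  rw [← hpe, quartic_apply]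
  simp only [pairing_cross_eq_cubic]
  ring

theorem hasDerivAt_quartic (h : IsComposition N) [FiniteDimensional ℂ A] {w : ℂ → Zorn A}
    {z α' β' : ℂ} {r' s' : Herm3 A} (hw : HasWeakDerivAt w (α', r', s', β') z)
    {α β : ℂ} {r s : Herm3 A} (hwz : w z = (α, r, s, β)) :
    HasDerivAt (fun z => quartic N (w z))
      (2 * (3 * α * β - 1 / 2 * pairing N r s)
          * (3 * α' * β + 3 * α * β' - 1 / 2 * (pairing N r' s + pairing N r s'))
        + 1 / 3 * (β' * cubic N r r r + 3 * β * cubic N r r r'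
          + α' * cubic N s s s + 3 * α * cubic N s s s')
        - 1 / 3 * (pairing N (cross N s s') (cross N r r)
          + pairing N (cross N s s) (cross N r r'))) z := by
  have hα : HasDerivAt (fun z => (w z).1) α' z :=
    (hw.linear (LinearMap.fst ℂ ℂ (Herm3 A × Herm3 A × ℂ))).hasDerivAt
  have hr : HasWeakDerivAt (fun z => (w z).2.1) r' z :=
    hw.linear (LinearMap.fst ℂ _ _ ∘ₗ LinearMap.snd ℂ ℂ (Herm3 A × Herm3 A × ℂ))
  have hs : HasWeakDerivAt (fun z => (w z).2.2.1) s' z :=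
    hw.linear (LinearMap.fst ℂ _ _ ∘ₗ LinearMap.snd ℂ _ _ ∘ₗ
      LinearMap.snd ℂ ℂ (Herm3 A × Herm3 A × ℂ))
  have hβ : HasDerivAt (fun z => (w z).2.2.2) β' z :=
    (hw.linear (LinearMap.snd ℂ _ _ ∘ₗ LinearMap.snd ℂ _ _ ∘ₗ
      LinearMap.snd ℂ ℂ (Herm3 A × Herm3 A × ℂ))).hasDerivAt
  have h1 := ((hα.const_mul 3).fun_mul hβ).fun_sub ((hr.pairing (N := N) hs).const_mul (1 / 2))
  have h2 := ((hβ.fun_mul (hr.cubic_self h)).fun_add (hα.fun_mul (hs.cubic_self h))).const_mul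
    (1 / 3)
  have h3 := (((hs.cross (N := N) hs).pairing (N := N) (hr.cross (N := N) hr))).const_mul (1 / 6)
  simp_rw [quartic_apply]
  refine (((h1.fun_pow 2).fun_add h2).fun_sub h3).congr_deriv ?_
  simp only [hwz, cross_comm N r' r, cross_comm N s' s, pairing_add_left, pairing_add_right]
  push_cast
  ring

/-- `𝔰𝔭₆(A)` annihilates the quartic form: the part `𝔰𝔩₃(A)` preserves every term of it, the
centre preserves it because its terms have weight zero, and the parts `W` and `W*` preserve it by
the polarized adjoint identity. -/
theorem hasDerivAt_quartic_sp6 (h : IsComposition N) [FiniteDimensional ℂ A] {X : End ℂ (Zorn A)}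
    (hX : X ∈ sp6 N) {w : ℂ → Zorn A} {z : ℂ} (hw : HasWeakDerivAt w (X (w z)) z) :
    HasDerivAt (fun z => quartic N (w z)) 0 z := by
  obtain ⟨D, hD, D', hDD', c, t, u, hX⟩ := hX
  change IsContragredient N D D' at hDD'
  obtain ⟨⟨α, r, s, β⟩, hwz⟩ : ∃ v, w z = v := ⟨_, rfl⟩
  rw [hwz, hX] at hw
  refine (hasDerivAt_quartic h hw hwz).congr_deriv ?_
  have hD' := hDD'.mem_sl3 h hD
  have d1 := hDD' r s
  have d2 : cubic N r r (D r) = 0 := by rw [← cubic_rotate h]; exact hD r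
  have d3 : cubic N s s (D' s) = 0 := by rw [← cubic_rotate h]; exact hD' s
  have d4 := hDD' (cross N s s) (cross N r r)
  rw [hDD'.apply_cross_self h hD, hDD'.symm.apply_cross_self h hD', pairing_smul_left,
    pairing_smul_right] at d4
  have t1 := congrArg (pairing N s) (two_smul_cross_cross h r t)
  have u1 := congrArg (pairing N r) (two_smul_cross_cross h s u)
  have t2 : pairing N s (cross N (cross N r t) (cross N r r))
      = pairing N (cross N s (cross N r t)) (cross N r r) := by
    rw [pairing_comm, pairing_cross_eq_cubic, cubic_comm_right h, cubic_comm_left, cubic]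
  have u2 : pairing N r (cross N (cross N s u) (cross N s s))
      = pairing N (cross N s s) (cross N r (cross N s u)) := by
    rw [pairing_comm, pairing_cross_eq_cubic, cubic_comm_right h, cubic_comm_left, cubic,
      pairing_comm]
  have e1 : pairing N (cross N s u) s = pairing N (cross N s s) u := cubic_comm_right h s u s
  have e2 : pairing N r (cross N r t) = pairing N (cross N r r) t := by
    rw [pairing_comm]
    exact cubic_comm_right h r t r
  simp only [sub_eq_add_neg (D r), ← neg_smul, pairing_add_left, pairing_add_right,
    pairing_smul_left, pairing_smul_right, cross_add_right, cross_smul_right, cubic]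
    at d1 d2 d3 d4 t1 u1 t2 u2 ⊢
  rw [t2, pairing_comm N s r, pairing_comm N s t] at t1
  rw [u2] at u1
  rw [e1, e2, pairing_comm N (cross N s u) (cross N r r),
    pairing_comm N (cross N s s) (cross N r r)]
  linear_combination -(3 * α * β - 1 / 2 * pairing N r s) * d1 + β * d2 + α * d3 - 1 / 6 * d4
    - 1 / 6 * t1 - 1 / 6 * u1

theorem isInvariant_quartic (h : IsComposition N) [FiniteDimensional ℂ A] :
    IsInvariant N (quartic N) := by
  intro g hg
  induction hg using Subgroup.closure_induction with
  | mem g hg =>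
    obtain ⟨X, hX, hgX⟩ := hg
    intro v
    have := eq_of_forall_hasDerivAt_zero
      (fun z => hasDerivAt_quartic_sp6 h hX (hasWeakDerivAt_endExp X v z)) 1 0
    simpa [hgX, endExp_zero] using this
  | one => simp
  | mul g g' _ _ hg hg' => exact fun v => (hg _).trans (hg' v)
  | inv g _ hg =>
    intro v
    rw [← hg, ← Module.End.mul_apply, ← Units.val_mul, mul_inv_cancel]
    rfl

end Invariance

section Flow

variable {A : Type*} [NonAssocRing A] [Module ℂ A] [IsScalarTower ℂ A A] [SMulCommClass ℂ A A]
  {N : QuadraticForm ℂ A} [FiniteDimensional ℂ A] {F : Zorn A → ℂ}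

/-! ### Invariant functions along flows -/

theorem smul_mem_sp6 {X : End ℂ (Zorn A)} (hX : X ∈ sp6 N) (z : ℂ) : z • X ∈ sp6 N := by
  obtain ⟨D, hD, D', hDD', c, t, u, hX⟩ := hX
  refine ⟨z • D, fun r => ?_, z • D', fun r s => ?_, z * c, z • t, z • u, fun α r s β => ?_⟩
  · rw [LinearMap.smul_apply, cubic, cross_smul_left, pairing_smul_left, ← cubic, hD, mul_zero]
  · rw [LinearMap.smul_apply, LinearMap.smul_apply, pairing_smul_left, pairing_smul_right,
      ← mul_add, hDD', mul_zero]
  · rw [LinearMap.smul_apply, hX]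
    simp only [Prod.smul_mk, Prod.mk.injEq, pairing_smul_left, pairing_smul_right,
      cross_smul_right, smul_eq_mul, LinearMap.smul_apply]
    refine ⟨by ring, by module, by module, by ring⟩

/-- An invariant polynomial is constant along the integral curves of the elements of
`𝔰𝔭₆(A)`. -/
theorem IsInvariant.eq_of_flow (hF : IsInvariant N F) (hFp : IsPolynomial F)
    {X : End ℂ (Zorn A)} (hX : X ∈ sp6 N) {w : ℂ → Zorn A}
    (hw : ∀ z, HasWeakDerivAt w (X (w z)) z) : F (w 1) = F (w 0) := by
  obtain ⟨p, hp⟩ := hFp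
  have h1 : ∀ v, polyDeriv p v (X v) = 0 := by
    intro v
    have h2 := (hasWeakDerivAt_endExp X v 0).polynomial p
    simp only [← hp] at h2
    have h3 : ∀ z : ℂ, F (endExp (z • X) v) = F v := fun z =>
      hF (isUnit_endExp (z • X)).unit
        (Subgroup.subset_closure ⟨z • X, smul_mem_sp6 hX z, rfl⟩) v
    simp only [h3, zero_smul, endExp_zero, Module.End.one_apply] at h2
    exact h2.unique (hasDerivAt_const _ _)
  refine eq_of_forall_hasDerivAt_zero (f := fun z => F (w z)) (fun z => ?_) 1 0
  have h2 := (hw z).polynomial p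
  simpa only [← hp, h1] using h2

/-- For `X⁴ v = 0` the integral curve through `v` is the polynomial `exp (zX) v` of degree three. -/
theorem IsInvariant.eq_of_nilpotent (hF : IsInvariant N F) (hFp : IsPolynomial F)
    {X : End ℂ (Zorn A)} (hX : X ∈ sp6 N) (v : Zorn A) (hv : X (X (X (X v))) = 0) :
    F (v + X v + (1 / 2 : ℂ) • X (X v) + (1 / 6 : ℂ) • X (X (X v))) = F v := by
  have := hF.eq_of_flow hFp hX (w := fun z => v + z • X v + (z ^ 2 / 2) • X (X v)
    + (z ^ 3 / 6) • X (X (X v))) fun z => ?_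
  · simpa using this
  · have h2 : HasDerivAt (fun z : ℂ => z ^ 2 / 2) z z := by
      refine ((hasDerivAt_pow 2 z).div_const 2).congr_deriv (by push_cast; ring)
    have h3 : HasDerivAt (fun z : ℂ => z ^ 3 / 6) (z ^ 2 / 2) z := by
      refine ((hasDerivAt_pow 3 z).div_const 6).congr_deriv (by push_cast; ring)
    convert ((hasWeakDerivAt_line v (X v) z).add (hasWeakDerivAt_smul h2 (X (X v)))).add
      (hasWeakDerivAt_smul h3 (X (X (X v)))) using 1
    simp only [map_add, map_smul, hv]
    module

/-- The action of `u ∈ W*` on `𝒵₂(A)`. -/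
noncomputable def dualShift (N : QuadraticForm ℂ A) (u : Herm3 A) : End ℂ (Zorn A) where
  toFun v := (1 / 2 * pairing N v.2.1 u, cross N v.2.2.1 u, (3 * v.2.2.2) • u, 0)
  map_add' v w := by
    simp only [Prod.fst_add, Prod.snd_add, pairing_add_left, cross_add_left, Prod.mk_add_mk,
      Prod.mk.injEq, add_zero, and_true]
    exact ⟨by ring, trivial, by module⟩
  map_smul' a v := by
    simp only [Prod.smul_fst, Prod.smul_snd, pairing_smul_left, cross_smul_left, Prod.smul_mk,
      Prod.mk.injEq, RingHom.id_apply, smul_eq_mul]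
    exact ⟨by ring, trivial, by module, by ring⟩

theorem dualShift_mem_sp6 (N : QuadraticForm ℂ A) (u : Herm3 A) : dualShift N u ∈ sp6 N := by
  have h0 : ∀ r, pairing N r 0 = 0 := fun r => (pairingBilin N r).map_zero
  have h0' : ∀ r, pairing N 0 r = 0 := fun r => (pairingBilin N).map_zero₂ r
  have h1 : ∀ r, cross N r 0 = 0 := fun r => (crossBilin N r).map_zero
  have h1' : ∀ r, cross N 0 r = 0 := fun r => (crossBilin N).map_zero₂ r
  refine ⟨0, fun r => by simp [cubic, h1', h0'], 0, fun r s => by simp [h0, h0'], 0, 0, u,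
    fun α r s β => ?_⟩
  simp [dualShift, h0', h1]

/-- The action of an endomorphism of `W` and of its contragredient on `𝒵₂(A)`. -/
def leviAction (D D' : End ℂ (Herm3 A)) : End ℂ (Zorn A) :=
  LinearMap.prodMap 0 (LinearMap.prodMap D (LinearMap.prodMap D' 0))

theorem leviAction_mem_sp6 {D D' : End ℂ (Herm3 A)} (hD : D ∈ sl3 N)
    (hDD' : IsContragredient N D D') : leviAction D D' ∈ sp6 N := by
  have h0' : ∀ r, pairing N 0 r = 0 := fun r => (pairingBilin N).map_zero₂ r
  have h0 : ∀ r, pairing N r 0 = 0 := fun r => (pairingBilin N r).map_zero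
  have h1 : ∀ r, cross N r 0 = 0 := fun r => (crossBilin N r).map_zero
  refine ⟨D, hD, D', hDD', 0, 0, 0, fun α r s β => ?_⟩
  simp [leviAction, h0, h0', h1]

theorem IsInvariant.eq_of_sl3_flow (h : IsComposition N) (hF : IsInvariant N F)
    (hFp : IsPolynomial F) {D : End ℂ (Herm3 A)} (hD : D ∈ sl3 N) {r : ℂ → Herm3 A}
    (hr : ∀ z, HasWeakDerivAt r (D (r z)) z) (α β : ℂ) :
    F (α, r 1, 0, β) = F (α, r 0, 0, β) := by
  obtain ⟨D', hDD'⟩ := exists_isContragredient h D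
  refine hF.eq_of_flow hFp (leviAction_mem_sp6 hD hDD') (w := fun z => (α, r z, 0, β))
    fun z => ?_
  have h1 := (hasWeakDerivAt_line ((α, 0, 0, β) : Zorn A) 0 z).add ((hr z).linear
    (LinearMap.inr ℂ ℂ (Herm3 A × Herm3 A × ℂ) ∘ₗ LinearMap.inl ℂ (Herm3 A) (Herm3 A × ℂ)))
  convert h1 using 1
  · simp
  · simp [leviAction]

theorem IsInvariant.eq_of_sl3_nilpotent (h : IsComposition N) (hF : IsInvariant N F)
    (hFp : IsPolynomial F) {D : End ℂ (Herm3 A)} (hD : D ∈ sl3 N) (r : Herm3 A)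
    (hr : D (D (D r)) = 0) (α β : ℂ) :
    F (α, r + D r + (1 / 2 : ℂ) • D (D r), 0, β) = F (α, r, 0, β) := by
  obtain ⟨D', hDD'⟩ := exists_isContragredient h D
  have := hF.eq_of_nilpotent hFp (leviAction_mem_sp6 hD hDD') (α, r, 0, β)
    (by simp [leviAction, hr])
  simpa [leviAction, hr] using this

end Flow

section Elimination

variable {A : Type*} [NonAssocRing A] [Module ℂ A] [IsScalarTower ℂ A A] [SMulCommClass ℂ A A]
  {N : QuadraticForm ℂ A}

/-! ### Row operations and the torus in `𝔰𝔩₃(A)` -/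

theorem mem_sl3_of_traceForm_com (h : IsComposition N) {D : End ℂ (Herm3 A)}
    (hD : ∀ r, traceForm N (com N r) (D r) = 0) : D ∈ sl3 N := by
  intro r
  rw [cubic_rotate h, cubic, cross_self, pairing_smul_left, pairing, hD]
  ring

/-- The row operation `r ↦ E r + r E*` for the matrix `E` with entry `a` in position `(1, 0)`. -/
def rowOp10 (N : QuadraticForm ℂ A) (a : A) : End ℂ (Herm3 A) where
  toFun r := (![0, polar N a (r.2 2), 0], ![r.2 1 * conj N a, 0, r.1 0 • a])
  map_add' r s := by
    refine Prod.ext ?_ ?_ <;> funext i <;> fin_cases i <;>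
      simp [polar_add_right, add_mul, add_smul]
  map_smul' c r := by
    refine Prod.ext ?_ ?_ <;> funext i <;> fin_cases i <;>
      simp [polar_smul_right, smul_mul_assoc, mul_smul]

/-- The row operation `r ↦ E r + r E*` for the matrix `E` with entry `a` in position `(2, 0)`. -/
def rowOp20 (N : QuadraticForm ℂ A) (a : A) : End ℂ (Herm3 A) where
  toFun r := (![0, 0, polar N a (r.2 1)], ![a * conj N (r.2 2), r.1 0 • a, 0])
  map_add' r s := by
    refine Prod.ext ?_ ?_ <;> funext i <;> fin_cases i <;>
      simp [polar_add_right, conj_add, mul_add, add_smul]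
  map_smul' c r := by
    refine Prod.ext ?_ ?_ <;> funext i <;> fin_cases i <;>
      simp [polar_smul_right, conj_smul, mul_smul_comm, mul_smul]

/-- The row operation `r ↦ E r + r E*` for the matrix `E` with entry `a` in position `(2, 1)`. -/
def rowOp21 (N : QuadraticForm ℂ A) (a : A) : End ℂ (Herm3 A) where
  toFun r := (![0, 0, polar N a (r.2 0)], ![r.1 1 • a, a * r.2 2, 0])
  map_add' r s := by
    refine Prod.ext ?_ ?_ <;> funext i <;> fin_cases i <;>
      simp [polar_add_right, mul_add, add_smul]
  map_smul' c r := by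
    refine Prod.ext ?_ ?_ <;> funext i <;> fin_cases i <;>
      simp [polar_smul_right, mul_smul_comm, mul_smul]

/-- For `a` of sum zero, the operation `r ↦ E r + r E*` for `E = diag(a₀, a₁, a₂)`: the
off-diagonal entry in position `(j, k)` is multiplied by `aⱼ + aₖ = -aᵢ`. -/
def torusOp (A : Type*) [NonAssocRing A] [Module ℂ A] (a : Fin 3 → ℂ) : End ℂ (Herm3 A) where
  toFun r := (fun i => 2 * a i * r.1 i, fun i => -a i • r.2 i)
  map_add' r s := by
    refine Prod.ext ?_ ?_ <;> funext i
    · simp [mul_add]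
    · simp
  map_smul' c r := by
    refine Prod.ext ?_ ?_ <;> funext i
    · simp; ring
    · exact smul_comm _ _ _

theorem rowOp10_mem_sl3 (h : IsComposition N) (a : A) : rowOp10 N a ∈ sl3 N := by
  refine mem_sl3_of_traceForm_com h fun r => ?_
  have e1 := polar_mul_mul_left h (conj N (r.2 2)) (conj N a) (r.2 1)
  have e2 := polar_mul_conj N h (r.2 0) (r.2 1) a
  have e3 := polar_conj_mul N h a (r.2 1) (r.2 0)
  rw [polar_comm] at e3
  simp [rowOp10, com, traceForm, Fin.sum_univ_three, polar_sub_left, polar_smul_left,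
    polar_smul_right, polar_conj_conj h, e1, e2, e3, polar_comm N a]
  ring

theorem rowOp20_mem_sl3 (h : IsComposition N) (a : A) : rowOp20 N a ∈ sl3 N := by
  refine mem_sl3_of_traceForm_com h fun r => ?_
  have e1 := polar_mul_conj N h (r.2 0) a (r.2 2)
  simp [rowOp20, com, traceForm, Fin.sum_univ_three, polar_sub_left, polar_smul_left,
    polar_smul_right, polar_mul_mul_right h, map_conj h, e1, polar_comm N a]
  ring

theorem rowOp21_mem_sl3 (h : IsComposition N) (a : A) : rowOp21 N a ∈ sl3 N := by
  refine mem_sl3_of_traceForm_com h fun r => ?_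
  have e1 := polar_mul_conj N h a (r.2 1) (r.2 2)
  rw [polar_comm, polar_comm N _ (r.2 1)] at e1
  simp [rowOp21, com, traceForm, Fin.sum_univ_three, polar_sub_left, polar_smul_left,
    polar_smul_right, polar_mul_mul_right h, e1, polar_comm N a]
  ring

theorem torusOp_mem_sl3 (h : IsComposition N) {a : Fin 3 → ℂ} (ha : a 0 + a 1 + a 2 = 0) :
    torusOp A a ∈ sl3 N := by
  refine mem_sl3_of_traceForm_com h fun r => ?_
  have e0 := polar_mul_conj N h (r.2 0) (r.2 1) (r.2 2)
  have e2 := polar_conj_mul N h (r.2 2) (r.2 1) (r.2 0)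
  rw [polar_comm] at e0 e2
  have ha' : a 2 = -a 0 - a 1 := by linear_combination ha
  simp [torusOp, com, traceForm, Fin.sum_univ_three, polar_sub_left, polar_smul_left,
    polar_smul_right, e0, e2, ha']
  ring

/-! ### Vanishing of invariant functions -/

variable [FiniteDimensional ℂ A] {F : Zorn A → ℂ}

theorem IsInvariant.sub_const_mul {G : Zorn A → ℂ} (hF : IsInvariant N F) (hG : IsInvariant N G)
    (c : ℂ) : IsInvariant N fun v => F v - c * G v := fun g hg v => by
  simp only [hF g hg v, hG g hg v]

/-- A nondegenerate diagonal matrix is moved to a homothety by the torus. -/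
theorem IsInvariant.eq_homothety (h : IsComposition N) (hF : IsInvariant N F)
    (hFp : IsPolynomial F) (α β : ℂ) (σ : Fin 3 → ℂ) (hσ : ∀ i, σ i ≠ 0) :
    ∃ b, F (α, (σ, 0), 0, β) = F (α, homothety b, 0, β) := by
  -- taking the mean of the logarithms of the `σ i`, and not a cube root of their product, makes
  -- the trace of `a` vanish exactly and not only modulo `2πi`
  set m := (Complex.log (σ 0) + Complex.log (σ 1) + Complex.log (σ 2)) / 3 with hm
  refine ⟨Complex.exp m, ?_⟩
  set a : Fin 3 → ℂ := fun i => (m - Complex.log (σ i)) / 2 with ha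
  have ha0 : a 0 + a 1 + a 2 = 0 := by
    simp only [ha, hm]
    ring
  set w : ℂ → Herm3 A := fun z =>
    ∑ i, Complex.exp (z * (2 * a i)) • ((Pi.single i (σ i), 0) : Herm3 A) with hw
  have hw0 : w 0 = (σ, 0) := by
    refine Prod.ext ?_ ?_
    · funext i
      fin_cases i <;> simp [hw, Fin.sum_univ_three]
    · simp [hw, Fin.sum_univ_three]
  have hw1 : w 1 = homothety (Complex.exp m) := by
    refine Prod.ext ?_ ?_
    · funext i
      have hi : Complex.exp (1 * (2 * a i)) * σ i = Complex.exp m := by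
        have : 1 * (2 * a i) = m - Complex.log (σ i) := by
          simp only [ha]
          ring
        rw [this, Complex.exp_sub, Complex.exp_log (hσ i), div_mul_cancel₀ _ (hσ i)]
      rw [homothety, ← hi]
      fin_cases i <;> simp [hw, Fin.sum_univ_three]
    · simp [hw, homothety, Fin.sum_univ_three]
  rw [← hw0, ← hw1]
  refine (hF.eq_of_sl3_flow h hFp (torusOp_mem_sl3 h ha0) (fun z => ?_) α β).symm
  have hd : ∀ i, HasDerivAt (fun z : ℂ => Complex.exp (z * (2 * a i)))
      (Complex.exp (z * (2 * a i)) * (2 * a i)) z := fun i => by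
    simpa using ((hasDerivAt_id z).mul_const (2 * a i)).cexp
  convert HasWeakDerivAt.sum Finset.univ fun i =>
    hasWeakDerivAt_smul (hd i) ((Pi.single i (σ i), 0) : Herm3 A) using 1
  refine Prod.ext ?_ ?_
  · funext i
    fin_cases i <;> simp [hw, Fin.sum_univ_three, torusOp] <;> ring
  · funext i
    simp [hw, Fin.sum_univ_three, torusOp]

/-- Uniqueness: an invariant polynomial that vanishes on the binary cubics is zero. -/
theorem IsInvariant.eq_zero (h : IsComposition N) (hF : IsInvariant N F) (hFp : IsPolynomial F)
    (hF0 : ∀ P : Cubic ℂ, F (ofCubic P) = 0) (v : Zorn A) : F v = 0 := by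
  -- `d i` is the linear form reading the `i`-th diagonal entry of `r`
  let d (i : Fin 3) : Dual ℂ (Zorn A) := LinearMap.proj i ∘ₗ LinearMap.fst ℂ _ _ ∘ₗ
    LinearMap.fst ℂ _ _ ∘ₗ LinearMap.snd ℂ ℂ (Herm3 A × Herm3 A × ℂ)
  -- a condition that the `i`-th diagonal entry of `r` is nonzero can be dropped, by moving along
  -- the line in this coordinate
  have hline : ∀ (i : Fin 3) (α β : ℂ) (r : Herm3 A),
      (∀ z : ℂ, (r + z • ((Pi.single i 1, 0) : Herm3 A)).1 i ≠ 0 →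
        F (α, r + z • ((Pi.single i 1, 0) : Herm3 A), 0, β) = 0) → F (α, r, 0, β) = 0 := by
    intro i α β r hr
    refine hFp.eq_zero_of_line (isPolynomial_linear (d i)) (α, r, 0, β)
      (0, (Pi.single i 1, 0), 0, 0) (fun z hz => ?_) (1 - r.1 i) ?_
    · simpa using hr z (by simpa [d] using hz)
    · simp [d]
  -- elimination, with more and more off-diagonal entries allowed to be nonzero
  have hdiag : ∀ (α β : ℂ) (σ : Fin 3 → ℂ), F (α, (σ, 0), 0, β) = 0 := by
    intro α β σ
    refine hline 0 α β _ fun z₀ h0 => hline 1 α β _ fun z₁ h1 => hline 2 α β _ fun z₂ h2 => ?_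
    simp only [Prod.smul_mk, Prod.mk_add_mk, smul_zero, add_zero] at *
    obtain ⟨b, hb⟩ := hF.eq_homothety h hFp α β
      (σ + z₀ • Pi.single 0 1 + z₁ • Pi.single 1 1 + z₂ • Pi.single 2 1)
      (by
        intro i
        fin_cases i
        · simpa using h0
        · simpa using h1
        · simpa using h2)
    rw [hb]
    exact hF0 ⟨α, b, 0, β⟩
  have hdiag' : ∀ (α β : ℂ) (r : Herm3 A), r.2 = 0 → F (α, r, 0, β) = 0 := by
    rintro α β ⟨σ, x⟩ rfl
    exact hdiag α β σ
  have hx0 : ∀ (α β : ℂ) (r : Herm3 A), r.2 1 = 0 → r.2 2 = 0 → F (α, r, 0, β) = 0 := by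
    intro α β r hr1 hr2
    refine hline 1 α β r fun z hz => ?_
    set r' := r + z • ((Pi.single 1 1, 0) : Herm3 A) with hr'
    have h1 : r'.2 1 = 0 := by simp [hr', hr1]
    have h2 : r'.2 2 = 0 := by simp [hr', hr2]
    rw [← hF.eq_of_sl3_nilpotent h hFp (rowOp21_mem_sl3 h (-(r'.1 1)⁻¹ • r'.2 0)) r' (by
      refine Prod.ext ?_ ?_ <;> funext i <;> fin_cases i <;> simp [rowOp21, h2])]
    refine hdiag' α β _ ?_
    funext i
    fin_cases i <;> simp [rowOp21, h1, h2, smul_smul, hz, -Matrix.add_cons]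
  have hx1 : ∀ (α β : ℂ) (r : Herm3 A), r.2 2 = 0 → F (α, r, 0, β) = 0 := by
    intro α β r hr2
    refine hline 0 α β r fun z hz => ?_
    set r' := r + z • ((Pi.single 0 1, 0) : Herm3 A) with hr'
    have h2 : r'.2 2 = 0 := by simp [hr', hr2]
    rw [← hF.eq_of_sl3_nilpotent h hFp (rowOp20_mem_sl3 h (-(r'.1 0)⁻¹ • r'.2 1)) r' (by
      refine Prod.ext ?_ ?_ <;> funext i <;> fin_cases i <;> simp [rowOp20])]
    refine hx0 α β _ ?_ ?_
    · simp [rowOp20, smul_smul, hz, -Matrix.add_cons]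
    · simp [rowOp20, h2, -Matrix.add_cons]
  have hs : ∀ (α β : ℂ) (r : Herm3 A), F (α, r, 0, β) = 0 := by
    intro α β r
    refine hline 0 α β r fun z hz => ?_
    set r' := r + z • ((Pi.single 0 1, 0) : Herm3 A) with hr'
    rw [← hF.eq_of_sl3_nilpotent h hFp (rowOp10_mem_sl3 h (-(r'.1 0)⁻¹ • r'.2 2)) r' (by
      refine Prod.ext ?_ ?_ <;> funext i <;> fin_cases i <;> simp [rowOp10])]
    refine hx1 α β _ ?_
    simp [rowOp10, smul_smul, hz, -Matrix.add_cons]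
  have hs' : ∀ w : Zorn A, w.2.2.1 = 0 → F w = 0 := by
    rintro ⟨α, r, s, β⟩ rfl
    exact hs α β r
  have hβ : ∀ w : Zorn A, w.2.2.2 ≠ 0 → F w = 0 := by
    rintro ⟨α, r, s, β⟩ hw
    change β ≠ 0 at hw
    -- the flow of `u` changes `s` to `s + 3βu`
    rw [← hF.eq_of_nilpotent hFp (dualShift_mem_sp6 N (-(3 * β)⁻¹ • s)) _
      (by
        have h0 : ∀ r, pairing N 0 r = 0 := fun r => (pairingBilin N).map_zero₂ r
        have h1 : ∀ r, cross N 0 r = 0 := fun r => (crossBilin N).map_zero₂ r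
        simp [dualShift, h0, h1])]
    refine hs' _ ?_
    simp [dualShift, smul_smul, hw, -mul_inv_rev]
  refine hFp.eq_zero_of_line (isPolynomial_linear (LinearMap.snd ℂ _ _ ∘ₗ LinearMap.snd ℂ _ _ ∘ₗ
      LinearMap.snd ℂ ℂ (Herm3 A × Herm3 A × ℂ))) v (0, 0, 0, 1) (fun z hz => hβ _ hz)
      (1 - v.2.2.2) ?_
  simp

end Elimination

end Freudenthal

open Freudenthal in
theorem mainTheorem11 {A : Type*} [NonAssocRing A] [Module ℂ A] [IsScalarTower ℂ A A]
    [SMulCommClass ℂ A A] [FiniteDimensional ℂ A] (N : QuadraticForm ℂ A)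
    (hN : Freudenthal.IsComposition N) :
    -- `Q` is an invariant quartic form
    Freudenthal.IsHomogeneousPolynomial 4 (Freudenthal.quartic N) ∧
    Freudenthal.IsInvariant N (Freudenthal.quartic N) ∧
    -- on the binary cubics, `3 Q` is the discriminant
    (∀ P : Cubic ℂ,
      3 * Freudenthal.quartic N (Freudenthal.ofCubic P) = Freudenthal.classicalDiscriminant P) ∧
    -- it is the only invariant polynomial with this restriction
    (∀ F : Freudenthal.Zorn A → ℂ, Freudenthal.IsPolynomial F → Freudenthal.IsInvariant N F →
      (∀ P : Cubic ℂ, F (Freudenthal.ofCubic P) = Freudenthal.classicalDiscriminant P) →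
      ∀ v, F v = 3 * Freudenthal.quartic N v) ∧
    -- on diagonal matrices, and so on all of the space when `A = 0`, it is the hyperdeterminant
    (∀ (α : ℂ) (r s : Fin 3 → ℂ) (β : ℂ),
      9 * Freudenthal.quartic N (α, (r, 0), (s, 0), β) =
        Freudenthal.hyperdeterminant (Freudenthal.toArray α r s β)) := by
  have hdisc : ∀ P : Cubic ℂ, 3 * quartic N (ofCubic P) = classicalDiscriminant P := by
    intro P
    simp [quartic, ofCubic, classicalDiscriminant, cubic, pairing, traceForm, cross_eq,
      homothety, Fin.sum_univ_three]
    ring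
  refine ⟨isHomogeneousPolynomial_quartic N, isInvariant_quartic hN, hdisc, ?_, ?_⟩
  · intro F hFp hF hF0 v
    refine sub_eq_zero.1 ((hF.sub_const_mul (isInvariant_quartic hN) 3).eq_zero hN
      (hFp.sub_const_mul (isHomogeneousPolynomial_quartic N).isPolynomial 3) (fun P => ?_) v)
    rw [hF0, hdisc, sub_self]
  · intro α r s β
    simp [quartic, hyperdeterminant, toArray, cubic, pairing, traceForm, cross_eq,
      Fin.sum_univ_three]
    ring
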